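/- Let $0<\alpha<1$ be real (rational or irrational). For a finite set $A$ of vertices of a graph let $e(A)$ be the number of edges inside $A$ and $\delta_\alpha(A)=|A|-\alpha e(A)$. Let $\mathbf K_\alpha$ be the class of finite graphs all of whose vertex subsets $A$ satisfy $\delta_\alpha(A)\ge 0$. For a graph $N$ all of whose finite induced subgraphs lie in $\mathbf K_\alpha$ and finite $A,B\subseteq N$ put $d_N(A)=\inf\{\delta_\alpha(A'):A\subseteq A'\subseteq N,\ A'\text{ finite}\}$ and $d_N(A/B)=d_N(A\cup B)-d_N(B)$. Write $A\le N$ if $d_N(A)=d_A(A)$. Let $\mathrm{icl}(A)$ be the union of all finite $B$ with $A\subseteq B\subseteq N$ for which no $A'\subsetneq B$ satisfies $A\subseteq A'\le B$. Call finite sets $A,B$ independent over a finite set $C$ if $d_N(A/C)=d_N(A/B\cup C)$ and $\mathrm{icl}(A\cup C)\cap\mathrm{icl}(B\cup C)\subseteq\mathrm{icl}(C)$. A countable graph $G$ is $(\mathbf K_\alpha,\le)$-generic if all its finite induced subgraphs are in $\mathbf K_\alpha$, the set $\mathrm{icl}(A)$ is finite for each finite $A\subseteq G$, and whenever $A\le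 G$ is finite and $A\le B\in\mathbf K_\alpha$, there is an embedding $g:B\to G$ over $A$ with $g(B)\le G$. Theorem. Let $G$ be $(\mathbf K_\alpha,\le)$-generic and let $\mathcal M$ be an $\aleph_0$-saturated graph elementarily equivalent to $G$ (for instance the monster model of $T_\alpha=\mathrm{Th}(G)$), with $d=d_{\mathcal M}$. Then there are $x,y,c\in\mathcal M$ such that $x\neq y$, $\{x\}$ and $\{y\}$ are independent over $\emptyset$, $d(c/xy)=0$, $d(c/x)>0$, $d(c/y)>0$, and $c\notin\mathrm{acl}(x,y)$. Moreover $p=\mathrm{tp}(c/xy)$ is a nonalgebraic complete type over the two-element set $\{x,y\}$ with $d(p)=0$, that is, $d(a/xy)=0$ for every realization $a$ of $p$. -/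

import Mathlib

open FirstOrder FirstOrder.Language

noncomputable section

namespace GenericGraph

universe u v w

/-! ### Predimension and dimension -/

section Dimension

variable {V : Type u}

/-- The number `e(A)` of edges of `G` with both endpoints in `A`. -/
def edgeCount (G : SimpleGraph V) (A : Set V) : ℕ :=
  {e : Sym2 V | e ∈ G.edgeSet ∧ ∀ v ∈ e, v ∈ A}.ncard

/-- The predimension `δ_α(A) = |A| - α e(A)` of (the subgraph induced on) a finite set `A`. -/
def predim (α : ℝ) (G : SimpleGraph V) (A : Set V) : ℝ :=
  (A.ncard : ℝ) - α * (edgeCount G A : ℝ)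

/-- Every finite subset has nonnegative predimension. For a finite graph this is membership in the
class `K_α`; for an arbitrary graph it is membership in the universal class determined by `K_α`. -/
def IsHereditarilyNonneg (α : ℝ) (G : SimpleGraph V) : Prop :=
  ∀ A : Set V, A.Finite → 0 ≤ predim α G A

/-- The dimension `d_N(A) = inf {δ(B) : A ⊆ B ⊆ N, B finite}`, for `A` finite. -/
def dimIn (α : ℝ) (G : SimpleGraph V) (N A : Set V) : ℝ :=
  sInf {r : ℝ | ∃ B : Set V, B.Finite ∧ A ⊆ B ∧ B ⊆ N ∧ r = predim α G B}

/-- The dimension `d(A)` computed in the whole graph, for `A` finite. -/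
def dim (α : ℝ) (G : SimpleGraph V) (A : Set V) : ℝ :=
  dimIn α G Set.univ A

/-- The relative dimension `d(A/B) = d(A ∪ B) - d(B)`, for `A` and `B` finite. -/
def relDim (α : ℝ) (G : SimpleGraph V) (A B : Set V) : ℝ :=
  dim α G (A ∪ B) - dim α G B

/-- `A ≤ N`: the finite set `A` is strong in `N`, that is `d_N(A) = d_A(A)`. -/
def IsStrong (α : ℝ) (G : SimpleGraph V) (A N : Set V) : Prop :=
  A ⊆ N ∧ dimIn α G N A = dimIn α G A A

/-- `A ≤ᵢ B`: the finite set `B` is an intrinsic extension of `A`, that is, there is no `A'`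
properly contained in `B` with `A ⊆ A' ≤ B`. -/
def IsIntrinsic (α : ℝ) (G : SimpleGraph V) (A B : Set V) : Prop :=
  A ⊆ B ∧ ¬ ∃ A' : Set V, A' ⊂ B ∧ A ⊆ A' ∧ IsStrong α G A' B

/-- The intrinsic closure of the finite set `A`: the union of its finite intrinsic extensions. -/
def icl (α : ℝ) (G : SimpleGraph V) (A : Set V) : Set V :=
  {v : V | ∃ B : Set V, B.Finite ∧ IsIntrinsic α G A B ∧ v ∈ B}

/-- `d`-independence of the finite sets `A` and `B` over the finite set `C`. -/
def DIndep (α : ℝ) (G : SimpleGraph V) (A B C : Set V) : Prop :=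
  relDim α G A C = relDim α G A (C ∪ B) ∧
    icl α G (A ∪ C) ∩ icl α G (B ∪ C) ⊆ icl α G C

/-- The countable graph `G` is the `(K_α, ≤)`-generic graph. -/
structure IsGeneric (α : ℝ) (G : SimpleGraph V) : Prop where
  countable : Countable V
  hereditary : IsHereditarilyNonneg α G
  extension : ∀ A : Set V, A.Finite → IsStrong α G A Set.univ →
    ∀ (n : ℕ) (H : SimpleGraph (Fin n)), IsHereditarilyNonneg α H →
    ∀ f : G.induce A ↪g H, IsStrong α H (Set.range f) Set.univ →
    ∃ g : H ↪g G, (∀ a : A, g (f a) = a) ∧ IsStrong α G (Set.range g) Set.univ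
  finite_closures : ∀ A : Set V, A.Finite → (icl α G A).Finite

/-- When all predimensions are nonnegative, `A ≤ N` says that no finite set between `A` and `N`
has smaller predimension than `A`. -/
theorem isStrong_iff {α : ℝ} {G : SimpleGraph V} (hG : IsHereditarilyNonneg α G) {A N : Set V}
    (hA : A.Finite) :
    IsStrong α G A N ↔
      A ⊆ N ∧ ∀ B : Set V, B.Finite → A ⊆ B → B ⊆ N → predim α G A ≤ predim α G B := by
  have hself : dimIn α G A A = predim α G A := by
    have h : {r : ℝ | ∃ B : Set V, B.Finite ∧ A ⊆ B ∧ B ⊆ A ∧ r = predim α G B}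
        = {predim α G A} := by
      ext r
      constructor
      · rintro ⟨B, -, h1, h2, rfl⟩
        rw [Set.Subset.antisymm h1 h2]
        rfl
      · rintro rfl
        exact ⟨A, hA, subset_rfl, subset_rfl, rfl⟩
    rw [dimIn, h, csInf_singleton]
  unfold IsStrong
  rw [hself]
  refine and_congr_right fun hAN => ⟨fun h B hB h1 h2 => ?_, fun h => ?_⟩
  · rw [← h]
    refine csInf_le ⟨0, ?_⟩ ⟨B, hB, h1, h2, rfl⟩
    rintro _ ⟨D, hD, -, -, rfl⟩
    exact hG D hD
  · refine IsLeast.csInf_eq ⟨⟨A, hA, subset_rfl, hAN, rfl⟩, ?_⟩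
    rintro _ ⟨D, hD, h1, h2, rfl⟩
    exact h D hD h1 h2

end Dimension

/-! ### Types, saturation and algebraic closure -/

section Types

variable (L : FirstOrder.Language.{v, w}) (M : Type u) [L.Structure M]

/-- The space `S₁(B)` of complete `1`-types over the parameter set `B ⊆ M`. -/
abbrev OneType (B : Set M) : Type _ :=
  ((L[[B]]).completeTheory M).CompleteType (Fin 1)

variable {L M}

/-- The element `a` of `M` satisfies every formula of the type `p`. -/
def RealizesType {B : Set M} (p : OneType L M B) (a : M) : Prop :=
  ∀ φ : (L[[B]]).Formula (Fin 1), Formula.equivSentence φ ∈ p → φ.Realize (fun _ => a)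

/-- The type `p` is algebraic: some formula of `p` has only finitely many solutions in `M`. -/
def IsAlgebraicType {B : Set M} (p : OneType L M B) : Prop :=
  ∃ φ : (L[[B]]).Formula (Fin 1), Formula.equivSentence φ ∈ p ∧
    {a : M | φ.Realize (fun _ => a)}.Finite

variable (L M)

/-- `M` is `κ`-saturated: complete `1`-types over fewer than `κ` parameters are realized in `M`. -/
def IsSaturated (κ : Cardinal.{u}) : Prop :=
  ∀ B : Set M, Cardinal.mk B < κ → ∀ p : OneType L M B, ∃ a : M, RealizesType p a

variable {M}

/-- The algebraic closure of `B`: the union of the finite `B`-definable subsets of `M`. -/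
def acl (B : Set M) : Set M :=
  {c : M | ∃ D : Set M, B.Definable₁ L D ∧ D.Finite ∧ c ∈ D}

end Types

/-- `d(p) = r` for a `1`-type `p` over a finite set `B`: the type is realized, and every
realization `a` has `d(a/B) = r`. -/
def HasDRank {M : Type u} [FirstOrder.Language.graph.Structure M] (α : ℝ) (G : SimpleGraph M) {B : Set M}
    (p : OneType FirstOrder.Language.graph M B) (r : ℝ) : Prop :=
  (∃ a : M, RealizesType p a) ∧ ∀ a : M, RealizesType p a → relDim α G {a} B = r

end GenericGraph

end

/-! Put λ = 1/α. The point c is the initial vertex of an infinite ladder over x and y: a path whose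
vertex i owns s(i+1) - s(i) edges, where s(0) = 0 and s(i) = ⌊iλ⌋ + 1 for i ≥ 1. Each vertex spends
one owned edge on continuing the path; one edge at the start goes to x, one at a position l goes to
y, and the others stay in the ladder. For large N the first N vertices together with x and y span at
least ⌊Nλ⌋ edges, so their predimension is at most 2 + α(Nλ - ⌊Nλ⌋). By Dirichlet's theorem Nλ comes
arbitrarily close to an integer from above, whence d(c/xy) = 0.

For lower bounds, each edge is charged to its owner. The excesses s(i) - iλ lie in [0, 1] and
telescope along the path; where a finite set breaks the path, the missing path edge pays for the
excess at the break. So the predimension is at least the number of base points in the set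
(`Rounding.add_leak_le_predim`), and a set that contains c but misses x or y loses a fixed further
amount (`Rounding.exists_gap`).

Finite pieces of many copies of the ladder, disjoint outside the base, embed strongly in G over a
strong nonadjacent pair, so each finite part of the description of c has infinitely many solutions
in G. Predimension bounds are expressed by first-order formulas about sets with m vertices and at
least e edges. Elementary equivalence and saturation therefore transfer the pair to M and yield a c
that realizes the whole description and no algebraic formula
(`IsSaturated.exists_realize_not_algebraic`). The description includes the formulas that force
d(c/xy) = 0, so every realization of tp(c/xy) has dimension 0. -/

open FirstOrder FirstOrder.Language

noncomputable section

namespace GenericGraph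

universe u v w

/-! ### Saturation and transfer of types between elementarily equivalent structures -/

section ModelTheory

variable {L : FirstOrder.Language.{v, w}} {M : Type u} [L.Structure M]

/-- A finitely satisfiable set of formulas over a finite parameter set is realized in an
`ℵ₀`-saturated structure. -/
theorem IsSaturated.exists_realize (hM : IsSaturated L M Cardinal.aleph0) {B : Set M}
    (hB : B.Finite) (Γ : Set ((L[[B]]).Formula (Fin 1)))
    (hΓ : ∀ Δ : Set ((L[[B]]).Formula (Fin 1)), Δ.Finite → Δ ⊆ Γ →
      ∃ a : M, ∀ φ ∈ Δ, φ.Realize (fun _ => a)) :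
    ∃ a : M, ∀ φ ∈ Γ, φ.Realize (fun _ => a) := by
  classical
  have hsat : (((L[[B]]).lhomWithConstants (Fin 1)).onTheory ((L[[B]]).completeTheory M) ∪
      Formula.equivSentence '' Γ).IsSatisfiable := by
    rw [Theory.isSatisfiable_iff_isFinitelySatisfiable]
    intro T0 hT0
    obtain ⟨a, ha⟩ := hΓ (Γ ∩ {φ | Formula.equivSentence φ ∈ T0})
      ((T0.finite_toSet.preimage (Formula.equivSentence.injective.injOn)).subset
        Set.inter_subset_right) Set.inter_subset_left
    let : (constantsOn (Fin 1)).Structure M := constantsOn.structure (fun _ => a)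
    have : Nonempty M := ⟨a⟩
    have hmod : M ⊨ (T0 : ((L[[B]])[[Fin 1]]).Theory) := by
      refine ⟨fun {σ} hσ => ?_⟩
      rcases hT0 hσ with h | ⟨φ, hφ, rfl⟩
      · have : M ⊨ ((L[[B]]).lhomWithConstants (Fin 1)).onTheory ((L[[B]]).completeTheory M) :=
          (LHom.onTheory_model _ _).2 inferInstance
        exact this.realize_of_mem _ h
      · exact (Formula.realize_equivSentence M φ).2 (ha φ ⟨hφ, hσ⟩)
    exact hmod.isSatisfiable
  have hne : {p : OneType L M B | Formula.equivSentence '' Γ ⊆ ↑p} ≠ ∅ := by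
    rw [Ne, Theory.CompleteType.setOfPred_subset_eq_empty_iff]
    exact not_not.2 hsat
  obtain ⟨p, hp⟩ := Set.nonempty_iff_ne_empty.2 hne
  obtain ⟨a, ha⟩ := hM B hB.lt_aleph0 p
  exact ⟨a, fun φ hφ => ha φ (hp ⟨φ, hφ, rfl⟩)⟩

/-- The formula over the parameter set `B` obtained by substituting parameters for the variables
indexed by `γ`. -/
def substParams {γ : Type} {B : Set M} (w : γ → B) (φ : L.Formula (γ ⊕ Fin 1)) :
    (L[[B]]).Formula (Fin 1) :=
  BoundedFormula.constantsVarsEquiv.symm (φ.relabel (Sum.map w id))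

theorem realize_substParams {γ : Type} {B : Set M} (w : γ → B) (φ : L.Formula (γ ⊕ Fin 1)) (a : M) :
    (substParams w φ).Realize (fun _ => a) ↔
      φ.Realize (Sum.elim (fun i => (w i : M)) (fun _ => a)) := by
  unfold substParams Formula.Realize
  rw [← BoundedFormula.realize_constantsVarsEquiv, Equiv.apply_symm_apply]
  refine (Formula.realize_relabel (φ := φ)).trans ?_
  unfold Formula.Realize
  rw [iff_iff_eq]
  congr 1
  ext (i | i) <;> simp

/-- Tuples in two structures that satisfy the same formulas. -/
def SameType {γ : Type} {N : Type*} [L.Structure N] (v : γ → N) (w : γ → M) : Prop :=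
  ∀ φ : L.Formula γ, φ.Realize v ↔ φ.Realize w

theorem SameType.exists_extend (hM : IsSaturated L M Cardinal.aleph0) {γ : Type} [Finite γ]
    {N : Type*} [L.Structure N] {v : γ → N} {w : γ → M} (h : SameType (L := L) v w) (b : N) :
    ∃ a : M, SameType (L := L) (Sum.elim v (fun _ : Fin 1 => b)) (Sum.elim w (fun _ => a)) := by
  classical
  let w' : γ → Set.range w := fun i => ⟨w i, i, rfl⟩
  obtain ⟨a, ha⟩ := hM.exists_realize (Set.finite_range w)
    (substParams w' '' {φ : L.Formula (γ ⊕ Fin 1) | φ.Realize (Sum.elim v (fun _ => b))}) (by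
      intro Δ hΔ hsub
      obtain ⟨Δ', hΔ', hfin, rfl⟩ := Set.exists_subset_image_finite_and.1
        ⟨Δ, hsub, hΔ, (rfl : Δ = Δ)⟩
      have : Finite Δ' := hfin
      -- The existence of a common solution of finitely many formulas is itself a formula about `v`,
      -- hence true of `w`.
      have h1 : (Formula.iExs (Fin 1) (Formula.iInf fun φ : Δ' => φ.1)).Realize v := by
        rw [Formula.realize_iExs]
        refine ⟨fun _ => b, ?_⟩
        rw [Formula.realize_iInf]
        exact fun φ => hΔ' φ.2
      rw [h, Formula.realize_iExs] at h1
      obtain ⟨a, ha⟩ := h1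
      rw [Formula.realize_iInf] at ha
      refine ⟨a 0, ?_⟩
      rintro _ ⟨φ, hφ, rfl⟩
      rw [realize_substParams]
      convert ha ⟨φ, hφ⟩ using 2
      ext i
      rw [Subsingleton.elim i 0])
  have key : ∀ φ : L.Formula (γ ⊕ Fin 1), φ.Realize (Sum.elim v (fun _ => b)) →
      φ.Realize (Sum.elim w (fun _ => a)) := fun φ hφ =>
    (realize_substParams w' φ a).1 (ha _ ⟨φ, hφ, rfl⟩)
  refine ⟨a, fun φ => ⟨key φ, fun hφ => ?_⟩⟩
  by_contra hn
  exact key φ.not hn hφ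

/-- The formula saying that `φ` has at least `k` solutions in its last variable. -/
def atLeast {γ : Type} (k : ℕ) (φ : L.Formula (γ ⊕ Fin 1)) : L.Formula γ :=
  Formula.iExs (Fin k)
    ((Formula.iInf fun i : Fin k => φ.relabel (Sum.map id fun _ => i)) ⊓
      Formula.iInf fun ij : {ij : Fin k × Fin k // ij.1 ≠ ij.2} =>
        ((Term.var (Sum.inr ij.1.1)).equal (Term.var (Sum.inr ij.1.2))).not)

theorem realize_atLeast {γ : Type} {k : ℕ} {φ : L.Formula (γ ⊕ Fin 1)} {v : γ → M} :
    (atLeast k φ).Realize v ↔ ∃ f : Fin k ↪ M, ∀ i, φ.Realize (Sum.elim v (fun _ => f i)) := by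
  unfold atLeast
  rw [Formula.realize_iExs]
  have hcomp : ∀ (f : Fin k → M) (i : Fin k),
      Sum.elim v f ∘ Sum.map id (fun _ : Fin 1 => i) = Sum.elim v (fun _ => f i) := by
    intro f i
    ext (j | j) <;> rfl
  constructor
  · rintro ⟨f, hf⟩
    rw [Formula.realize_inf, Formula.realize_iInf, Formula.realize_iInf] at hf
    refine ⟨⟨f, fun i j hij => ?_⟩, fun i => ?_⟩
    · by_contra hne
      have := hf.2 ⟨(i, j), hne⟩
      rw [Formula.realize_not, Formula.realize_equal] at this
      exact this hij
    · have := hf.1 i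
      rwa [Formula.realize_relabel, hcomp] at this
  · rintro ⟨f, hf⟩
    refine ⟨f, ?_⟩
    rw [Formula.realize_inf, Formula.realize_iInf, Formula.realize_iInf]
    refine ⟨fun i => ?_, fun ij => ?_⟩
    · rw [Formula.realize_relabel, hcomp]
      exact hf i
    · rw [Formula.realize_not, Formula.realize_equal]
      exact fun h => ij.2 (f.injective h)

theorem SameType.infinite_of_infinite {γ : Type} {N : Type*} [L.Structure N] {v : γ → N}
    {w : γ → M} (h : SameType (L := L) v w) {φ : L.Formula (γ ⊕ Fin 1)}
    (hinf : {a : N | φ.Realize (Sum.elim v (fun _ => a))}.Infinite) :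
    {a : M | φ.Realize (Sum.elim w (fun _ => a))}.Infinite := by
  intro hfin
  have := hinf.to_subtype
  have h1 : (atLeast (hfin.toFinset.card + 1) φ).Realize v := by
    rw [realize_atLeast]
    exact ⟨Fin.valEmbedding.trans ((Infinite.natEmbedding _).trans
      (Function.Embedding.subtype _)), fun i => (Infinite.natEmbedding
        {a : N | φ.Realize (Sum.elim v (fun _ => a))} (i : ℕ)).2⟩
  rw [h, realize_atLeast] at h1
  obtain ⟨f, hf⟩ := h1
  have := Finset.card_le_card_of_injOn (s := Finset.univ) (t := hfin.toFinset) f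
    (fun i _ => by simpa using hf i) f.injective.injOn
  simp at this

theorem sameType_of_elementarilyEquivalent {N : Type*} [L.Structure N]
    (h : L.ElementarilyEquivalent N M) (v : Empty → N) (w : Empty → M) :
    SameType (L := L) v w := by
  intro φ
  rw [Subsingleton.elim v default, Subsingleton.elim w default]
  exact elementarilyEquivalent_iff.1 h φ

end ModelTheory

/-! ### Submodularity of the predimension and basic bounds on dimension -/

section Predimension

variable {V : Type*} {G : SimpleGraph V} {α : ℝ}

/-- The edges of `G` with both endpoints in `A`. -/
def edgesIn (G : SimpleGraph V) (A : Set V) : Set (Sym2 V) :=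
  {e : Sym2 V | e ∈ G.edgeSet ∧ ∀ v ∈ e, v ∈ A}

theorem edgeCount_eq_ncard (G : SimpleGraph V) (A : Set V) :
    edgeCount G A = (edgesIn G A).ncard := rfl

theorem finite_edgesIn {A : Set V} (hA : A.Finite) : (edgesIn G A).Finite := by
  refine ((hA.prod hA).image (fun p : V × V => s(p.1, p.2))).subset ?_
  rintro e ⟨-, he⟩
  induction e with
  | _ a b => exact ⟨(a, b), ⟨he a (by simp), he b (by simp)⟩, rfl⟩

theorem edgesIn_image {W : Type*} {H : SimpleGraph W} (g : H ↪g G) (B : Set W) :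
    edgesIn G (g '' B) = Sym2.map g '' edgesIn H B := by
  ext e
  constructor
  · rintro ⟨he, hv⟩
    induction e with
    | _ a b =>
      obtain ⟨a, ha, rfl⟩ := hv a (by simp)
      obtain ⟨b, hb, rfl⟩ := hv b (by simp)
      refine ⟨s(a, b), ⟨by simpa using he, ?_⟩, by simp⟩
      simp [ha, hb]
  · rintro ⟨e, ⟨he, hv⟩, rfl⟩
    induction e with
    | _ a b =>
      refine ⟨by simpa using he, ?_⟩
      have ha := hv a (by simp)
      have hb := hv b (by simp)
      simp only [Sym2.map_mk, Sym2.mem_iff]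
      rintro v (rfl | rfl)
      · exact ⟨a, ha, rfl⟩
      · exact ⟨b, hb, rfl⟩

theorem edgeCount_image {W : Type*} {H : SimpleGraph W} (g : H ↪g G) (B : Set W) :
    edgeCount G (g '' B) = edgeCount H B := by
  rw [edgeCount_eq_ncard, edgesIn_image, Set.ncard_image_of_injective _
    (Sym2.map.injective g.injective), edgeCount_eq_ncard]

theorem predim_image {W : Type*} {H : SimpleGraph W} (g : H ↪g G) (B : Set W) :
    predim α G (g '' B) = predim α H B := by
  rw [predim, predim, edgeCount_image, Set.ncard_image_of_injective _ g.injective]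

theorem predim_le_ncard (hα : 0 ≤ α) (A : Set V) : predim α G A ≤ A.ncard := by
  have : 0 ≤ α * (edgeCount G A : ℝ) := by positivity
  unfold predim
  linarith

/-- Vertices are counted modularly, while edges between `A \ B` and `B \ A` are counted only in the
union. -/
theorem predim_union_add_inter_le (hα : 0 ≤ α) {A B : Set V} (hA : A.Finite) (hB : B.Finite) :
    predim α G (A ∪ B) + predim α G (A ∩ B) ≤ predim α G A + predim α G B := by
  have h1 : (A ∪ B).ncard + (A ∩ B).ncard = A.ncard + B.ncard :=
    Set.ncard_union_add_ncard_inter A B hA hB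
  have h2 : edgeCount G A + edgeCount G B ≤ edgeCount G (A ∪ B) + edgeCount G (A ∩ B) := by
    simp only [edgeCount_eq_ncard]
    rw [← Set.ncard_union_add_ncard_inter _ _ (finite_edgesIn hA) (finite_edgesIn hB)]
    refine add_le_add (Set.ncard_le_ncard ?_ (finite_edgesIn (hA.union hB)))
      (Set.ncard_le_ncard ?_ (finite_edgesIn (hA.inter_of_left B)))
    · rintro e (he | he)
      · exact ⟨he.1, fun v hv => Or.inl (he.2 v hv)⟩
      · exact ⟨he.1, fun v hv => Or.inr (he.2 v hv)⟩
    · rintro e ⟨h, h'⟩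
      exact ⟨h.1, fun v hv => ⟨h.2 v hv, h'.2 v hv⟩⟩
  have h1' : ((A ∪ B).ncard : ℝ) + (A ∩ B).ncard = A.ncard + B.ncard := by exact_mod_cast h1
  have h2' : (edgeCount G A : ℝ) + edgeCount G B ≤ edgeCount G (A ∪ B) + edgeCount G (A ∩ B) := by
    exact_mod_cast h2
  have := mul_le_mul_of_nonneg_left h2' hα
  unfold predim
  linarith

theorem IsHereditarilyNonneg.bddBelow (hG : IsHereditarilyNonneg α G) (N A : Set V) :
    BddBelow {r : ℝ | ∃ B : Set V, B.Finite ∧ A ⊆ B ∧ B ⊆ N ∧ r = predim α G B} :=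
  ⟨0, by rintro _ ⟨B, hB, -, -, rfl⟩; exact hG B hB⟩

theorem dim_le_predim (hG : IsHereditarilyNonneg α G) {A B : Set V} (hB : B.Finite) (h : A ⊆ B) :
    dim α G A ≤ predim α G B :=
  csInf_le (hG.bddBelow _ _) ⟨B, hB, h, Set.subset_univ _, rfl⟩

theorem le_dim {A : Set V} (hA : A.Finite) {r : ℝ}
    (h : ∀ B : Set V, B.Finite → A ⊆ B → r ≤ predim α G B) : r ≤ dim α G A :=
  le_csInf ⟨_, A, hA, subset_rfl, Set.subset_univ _, rfl⟩
    (by rintro _ ⟨B, hB, hAB, -, rfl⟩; exact h B hB hAB)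

theorem dim_eq_ncard (hα : 0 ≤ α) (hG : IsHereditarilyNonneg α G) {A : Set V} (hA : A.Finite)
    (h : ∀ B : Set V, B.Finite → A ⊆ B → (A.ncard : ℝ) ≤ predim α G B) :
    dim α G A = A.ncard :=
  le_antisymm ((dim_le_predim hG hA subset_rfl).trans (predim_le_ncard hα A)) (le_dim hA h)

theorem dim_mono (hG : IsHereditarilyNonneg α G) {A B : Set V} (hB : B.Finite) (h : A ⊆ B) :
    dim α G A ≤ dim α G B :=
  le_dim hB fun _ hC hBC => dim_le_predim hG hC (h.trans hBC)

theorem icl_subset_of_isStrong (hG : IsHereditarilyNonneg α G) {A : Set V} (hA : A.Finite)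
    (h : IsStrong α G A Set.univ) : icl α G A ⊆ A := by
  rintro v ⟨B, hB, ⟨hAB, hno⟩, hv⟩
  by_contra hvA
  refine hno ⟨A, ⟨hAB, fun hBA => hvA (hBA hv)⟩, subset_rfl, ?_⟩
  rw [isStrong_iff hG hA] at h ⊢
  exact ⟨hAB, fun C hC h1 _ => h.2 C hC h1 (Set.subset_univ _)⟩

/-- Intersecting with a strong finite set does not increase the predimension. -/
theorem IsStrong.predim_inter_le (hα : 0 ≤ α) (hG : IsHereditarilyNonneg α G) {R B : Set V}
    (hR : R.Finite) (h : IsStrong α G R Set.univ) (hB : B.Finite) :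
    predim α G (B ∩ R) ≤ predim α G B := by
  have h1 := ((isStrong_iff hG hR).1 h).2 (B ∪ R) (hB.union hR) Set.subset_union_right
    (Set.subset_univ _)
  have h2 := predim_union_add_inter_le (G := G) hα hB hR
  linarith

end Predimension

/-! ### First-order expression of density -/

section DenseFormula

variable {M : Type*} [FirstOrder.Language.graph.Structure M] [M ⊨ Theory.simpleGraph]

/-- The formula saying that the variables take values in a set of `m` vertices that spans at least
`e` edges. -/
def denseFormula (γ : Type) [Finite γ] (m e : ℕ) : FirstOrder.Language.graph.Formula γ :=
  Formula.iSup fun P : {P : SimpleGraph (Fin m) × (γ → Fin m) // e ≤ edgeCount P.1 Set.univ} =>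
    Formula.iExs (Fin m)
      ((Formula.iInf fun ij : {ij : Fin m × Fin m // ij.1 ≠ ij.2} =>
        ((Term.var (Sum.inr ij.1.1)).equal (Term.var (Sum.inr ij.1.2))).not) ⊓
      ((Formula.iInf fun ij : {ij : Fin m × Fin m // P.1.1.Adj ij.1 ij.2} =>
        adj.formula₂ (Term.var (Sum.inr ij.1.1)) (Term.var (Sum.inr ij.1.2))) ⊓
      Formula.iInf fun i : γ => (Term.var (Sum.inl i)).equal (Term.var (Sum.inr (P.1.2 i)))))

theorem realize_denseFormula {γ : Type} [Finite γ] {m e : ℕ} {v : γ → M} :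
    (denseFormula γ m e).Realize v ↔ ∃ B : Set M, B.Finite ∧ (∀ i, v i ∈ B) ∧ B.ncard = m ∧
      e ≤ edgeCount (simpleGraphOfStructure M) B := by
  unfold denseFormula
  simp only [Formula.realize_iSup, Formula.realize_iExs, Formula.realize_inf, Formula.realize_iInf,
    Formula.realize_not, Formula.realize_equal, Term.realize_var, Sum.elim_inr, Sum.elim_inl,
    Formula.realize_rel₂]
  constructor
  · rintro ⟨⟨⟨P, f⟩, hP⟩, z, hinj, hadj, hv⟩
    have hz : Function.Injective z := fun i j hij => by
      by_contra hne
      exact hinj ⟨(i, j), hne⟩ hij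
    refine ⟨Set.range z, Set.finite_range z, fun i => ⟨f i, (hv i).symm⟩, ?_, hP.trans ?_⟩
    · rw [← Set.image_univ, Set.ncard_image_of_injective _ hz, Set.ncard_univ, Nat.card_fin]
    · rw [edgeCount_eq_ncard, edgeCount_eq_ncard,
        ← Set.ncard_image_of_injective _ (Sym2.map.injective hz)]
      refine Set.ncard_le_ncard ?_ (finite_edgesIn (Set.finite_range z))
      rintro _ ⟨e, ⟨he, -⟩, rfl⟩
      induction e with
      | _ a b =>
        refine ⟨hadj ⟨(a, b), he⟩, ?_⟩
        simp
  · rintro ⟨B, hB, hv, hm, he⟩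
    have : Finite B := hB
    have hcard : Nat.card B = m := hm
    let z : Fin m ≃ B := (Finite.equivFinOfCardEq hcard).symm
    let g : (simpleGraphOfStructure M).comap (fun i => (z i : M)) ↪g simpleGraphOfStructure M :=
      SimpleGraph.Embedding.comap ⟨fun i => (z i : M), Subtype.val_injective.comp z.injective⟩ _
    have hrange : g '' Set.univ = B := by
      ext b
      constructor
      · rintro ⟨i, -, rfl⟩
        exact (z i).2
      · intro hb
        exact ⟨z.symm ⟨b, hb⟩, trivial, congrArg Subtype.val (z.apply_symm_apply ⟨b, hb⟩)⟩
    refine ⟨⟨((simpleGraphOfStructure M).comap (fun i => (z i : M)),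
      fun i => z.symm ⟨v i, hv i⟩), ?_⟩, fun i => z i, ?_, ?_, ?_⟩
    · rwa [← edgeCount_image g, hrange]
    · rintro ij h
      exact ij.2 (z.injective (Subtype.ext h))
    · rintro ij
      exact ij.2
    · intro i
      simp

end DenseFormula

/-! ### The ladder graph and lower bounds for its predimension -/

section Ladder

/-- A rounding `s` of the sequence `i ↦ i * lam`, together with data selecting the vertices of a
ladder graph that are joined to its two base points. -/
structure Rounding (lam : ℝ) where
  /-- The rounded sequence. -/
  s : ℕ → ℕ
  /-- A bound for the increments of `s`. -/
  K : ℕ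
  /-- The position joined to the second base point. -/
  l : ℕ
  /-- The label of the edge to the second base point. -/
  b : ℕ
  s_zero : s 0 = 0
  lt_succ : ∀ i, s i + 1 ≤ s (i + 1)
  succ_le : ∀ i, s (i + 1) ≤ s i + K
  lower : ∀ i : ℕ, i * lam ≤ s i
  upper : ∀ i : ℕ, (s i : ℝ) ≤ i * lam + 1
  two_le : 2 ≤ s 1
  two_le_b : 2 ≤ b
  b_le : s l + b ≤ s (l + 1)
  ne_zero_two : ¬ (l = 0 ∧ b = 2)
  -- A set whose path breaks just before position j loses at least 1 - (s(j) - jλ); strictness up to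
  -- `l` makes this positive.
  strict : ∀ j : ℕ, 1 ≤ j → j ≤ l → (s j : ℝ) < j * lam + 1

namespace Rounding

variable {lam : ℝ} (R : Rounding lam)

/-- The endpoint of the edge labelled `d` that starts at position `i` of the `q`-th copy. -/
def target (q i d : ℕ) : Bool ⊕ (ℕ × ℕ) :=
  if d = 1 then Sum.inr (q, i + 1)
  else if i = 0 ∧ d = 2 then Sum.inl false
  else if i = R.l ∧ d = R.b then Sum.inl true
  else Sum.inr (q, if i < R.K then i + R.K + d else i - d)

/-- The increments of the rounding. -/
def incr (i : ℕ) : ℕ := R.s (i + 1) - R.s i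

theorem s_add_incr (i : ℕ) : R.s i + R.incr i = R.s (i + 1) := by
  have := R.lt_succ i
  unfold incr
  omega

theorem one_le_incr (i : ℕ) : 1 ≤ R.incr i := by
  have := R.lt_succ i
  unfold incr
  omega

theorem incr_le (i : ℕ) : R.incr i ≤ R.K := by
  have := R.succ_le i
  unfold incr
  omega

/-- The ladder graph: infinitely many copies of a path with additional edges, over the two base
points `Sum.inl false` and `Sum.inl true`. -/
def ladder : SimpleGraph (Bool ⊕ (ℕ × ℕ)) :=
  SimpleGraph.fromEdgeSet
    {e | ∃ q i d, 1 ≤ d ∧ d ≤ R.incr i ∧ e = s(Sum.inr (q, i), R.target q i d)}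

theorem target_ne {q i d : ℕ} (hd : 1 ≤ d) (hd' : d ≤ R.incr i) :
    (Sum.inr (q, i) : Bool ⊕ (ℕ × ℕ)) ≠ R.target q i d := by
  have := R.incr_le i
  unfold target
  split_ifs <;> simp <;> omega

theorem not_adj_base (u v : Bool) : ¬ R.ladder.Adj (Sum.inl u) (Sum.inl v) := by
  rw [ladder, SimpleGraph.fromEdgeSet_adj]
  rintro ⟨⟨q, i, d, -, -, h⟩, -⟩
  have : (Sum.inr (q, i) : Bool ⊕ (ℕ × ℕ)) ∈ s(Sum.inl u, Sum.inl v) := by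
    rw [h]
    simp
  simp at this

/-- The amount by which the rounding exceeds the linear sequence. -/
def excess (i : ℕ) : ℝ := R.s i - i * lam

theorem excess_nonneg (i : ℕ) : 0 ≤ R.excess i := sub_nonneg.2 (R.lower i)

theorem excess_le_one (i : ℕ) : R.excess i ≤ 1 := by
  have := R.upper i
  unfold excess
  linarith

theorem incr_eq (i : ℕ) : (R.incr i : ℝ) = lam + R.excess (i + 1) - R.excess i := by
  have : (R.s i : ℝ) + R.incr i = R.s (i + 1) := by exact_mod_cast R.s_add_incr i
  unfold excess
  push_cast
  linarith

section Count

variable {S : Set (Bool ⊕ (ℕ × ℕ))}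

open Classical in
/-- The labels of the edges starting at a given vertex and leaving `S`. -/
def leaving (S : Set (Bool ⊕ (ℕ × ℕ))) (p : ℕ × ℕ) : Finset ℕ :=
  (Finset.Icc 1 (R.incr p.2)).filter fun d => R.target p.1 p.2 d ∉ S

open Classical in
/-- The labels of the edges starting at a given vertex and ending in `S`. -/
def staying (S : Set (Bool ⊕ (ℕ × ℕ))) (p : ℕ × ℕ) : Finset ℕ :=
  (Finset.Icc 1 (R.incr p.2)).filter fun d => R.target p.1 p.2 d ∈ S

theorem card_staying_add_card_leaving (S : Set (Bool ⊕ (ℕ × ℕ))) (p : ℕ × ℕ) :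
    (R.staying S p).card + (R.leaving S p).card = R.incr p.2 := by
  rw [staying, leaving, Finset.card_filter_add_card_filter_not, Nat.card_Icc]
  simp

/-- The vertices of `S` other than base points. -/
def copies (hS : S.Finite) : Finset (ℕ × ℕ) :=
  (hS.preimage (Sum.inr_injective.injOn (s := Sum.inr ⁻¹' S))).toFinset

@[simp]
theorem mem_copies (hS : S.Finite) (p : ℕ × ℕ) : p ∈ copies hS ↔ Sum.inr p ∈ S := by
  simp [copies]

/-- Every edge inside `S` is charged to an owner in `S`. An upper bound suffices for bounding the
predimension from below, so coincidences between labels do not matter here. -/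
theorem edgeCount_le (hS : S.Finite) :
    edgeCount R.ladder S ≤ ∑ p ∈ copies hS, (R.staying S p).card := by
  classical
  rw [← Finset.card_sigma, edgeCount_eq_ncard]
  have hsub : edgesIn R.ladder S ⊆ (((copies hS).sigma fun p => R.staying S p).image
      fun a => s(Sum.inr a.1, R.target a.1.1 a.1.2 a.2) : Finset _) := by
    rintro e ⟨he, hv⟩
    rw [ladder, SimpleGraph.edgeSet_fromEdgeSet] at he
    obtain ⟨⟨q, i, d, h1, h2, rfl⟩, -⟩ := he
    rw [Finset.coe_image]
    refine ⟨⟨(q, i), d⟩, ?_, rfl⟩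
    simp only [Finset.coe_sigma, Set.mem_sigma_iff, Finset.mem_coe, mem_copies]
    refine ⟨hv _ (by simp), ?_⟩
    simp only [staying, Finset.mem_filter, Finset.mem_Icc]
    exact ⟨⟨h1, h2⟩, hv _ (by simp)⟩
  refine (Set.ncard_le_ncard hsub (Finset.finite_toSet _)).trans ?_
  rw [Set.ncard_coe_finset]
  exact Finset.card_image_le

open Classical in
/-- The contribution of a vertex of `S` to the predimension of `S`. -/
def leak (S : Set (Bool ⊕ (ℕ × ℕ))) (p : ℕ × ℕ) : ℝ :=
  (R.leaving S p).card - if Sum.inr (p.1, p.2 + 1) ∈ S then 0 else R.excess (p.2 + 1)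

theorem one_mem_leaving {p : ℕ × ℕ} (h : Sum.inr (p.1, p.2 + 1) ∉ S) : 1 ∈ R.leaving S p := by
  classical
  rw [leaving, Finset.mem_filter, Finset.mem_Icc]
  exact ⟨⟨le_rfl, R.one_le_incr _⟩, by simpa [target] using h⟩

theorem le_leak_of_not_mem {p : ℕ × ℕ} (h : Sum.inr (p.1, p.2 + 1) ∉ S) :
    1 - R.excess (p.2 + 1) ≤ R.leak S p := by
  rw [leak, if_neg h]
  have h1 : 1 ≤ (R.leaving S p).card := Finset.card_pos.2 ⟨1, R.one_mem_leaving h⟩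
  have h2 : (1 : ℝ) ≤ (R.leaving S p).card := by exact_mod_cast h1
  linarith

/-- If the successor is missing, the path edge leaves `S`, and this one edge covers an excess of at
most 1. -/
theorem leak_nonneg (S : Set (Bool ⊕ (ℕ × ℕ))) (p : ℕ × ℕ) : 0 ≤ R.leak S p := by
  by_cases h : Sum.inr (p.1, p.2 + 1) ∈ S
  · rw [leak, if_pos h]
    simp
  · have := R.le_leak_of_not_mem h
    have := R.excess_le_one (p.2 + 1)
    linarith

theorem one_le_leak {p : ℕ × ℕ} {d : ℕ} (hd : 2 ≤ d) (hd' : d ≤ R.incr p.2)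
    (h : R.target p.1 p.2 d ∉ S) : 1 ≤ R.leak S p := by
  have hmem : d ∈ R.leaving S p := by
    simp only [leaving, Finset.mem_filter, Finset.mem_Icc]
    exact ⟨⟨by omega, hd'⟩, h⟩
  by_cases h1 : Sum.inr (p.1, p.2 + 1) ∈ S
  · rw [leak, if_pos h1]
    have : 1 ≤ (R.leaving S p).card := Finset.card_pos.2 ⟨d, hmem⟩
    have : (1 : ℝ) ≤ (R.leaving S p).card := by exact_mod_cast this
    linarith
  · rw [leak, if_neg h1]
    have : 2 ≤ (R.leaving S p).card := by
      have : 1 < (R.leaving S p).card :=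
        Finset.one_lt_card.2 ⟨1, R.one_mem_leaving h1, d, hmem, by omega⟩
      omega
    have : (2 : ℝ) ≤ (R.leaving S p).card := by exact_mod_cast this
    have := R.excess_le_one (p.2 + 1)
    linarith

/-- The increment at i is λ plus the excess at i + 1 minus the excess at i. Summed over `S`, the
excess terms telescope along path edges within `S`, and `leak` absorbs those at the breaks. -/
theorem edgeCount_add_leak_le (hS : S.Finite) :
    (edgeCount R.ladder S : ℝ) + ∑ p ∈ copies hS, R.leak S p ≤ (copies hS).card * lam := by
  classical
  have h1 : (edgeCount R.ladder S : ℝ) ≤ ∑ p ∈ copies hS, ((R.staying S p).card : ℝ) := by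
    exact_mod_cast R.edgeCount_le hS
  -- The shift (q, i) ↦ (q, i + 1) is injective, so the excesses carried forward into `S` are among
  -- those subtracted there.
  have h2 : ∑ p ∈ copies hS, (if Sum.inr (p.1, p.2 + 1) ∈ S then R.excess (p.2 + 1) else 0)
      ≤ ∑ p ∈ copies hS, R.excess p.2 := by
    rw [← Finset.sum_filter]
    rw [← Finset.sum_image (s := (copies hS).filter fun p => Sum.inr (p.1, p.2 + 1) ∈ S)
      (g := fun p : ℕ × ℕ => (p.1, p.2 + 1)) (f := fun p => R.excess p.2)]
    · refine Finset.sum_le_sum_of_subset_of_nonneg ?_ fun p _ _ => R.excess_nonneg _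
      intro p hp
      simp only [Finset.mem_image, Finset.mem_filter] at hp
      obtain ⟨p', hp', rfl⟩ := hp
      rw [mem_copies]
      exact hp'.2
    · rintro ⟨a, i⟩ - ⟨a', i'⟩ - h
      simpa using h
  have h3 : ∀ p ∈ copies hS, ((R.staying S p).card : ℝ) + R.leak S p =
      lam - R.excess p.2 +
        (if Sum.inr (p.1, p.2 + 1) ∈ S then R.excess (p.2 + 1) else 0) := by
    intro p _
    have hc : ((R.staying S p).card : ℝ) + (R.leaving S p).card = R.incr p.2 := by
      exact_mod_cast R.card_staying_add_card_leaving S p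
    rw [R.incr_eq] at hc
    unfold leak
    split_ifs <;> linarith
  have h4 := Finset.sum_congr rfl h3
  rw [Finset.sum_add_distrib, Finset.sum_add_distrib, Finset.sum_sub_distrib, Finset.sum_const,
    nsmul_eq_mul] at h4
  linarith

/-- Since αλ = 1, the λ edges allotted to a ladder vertex exactly cancel its weight; only base
points and leaks remain. -/
theorem add_leak_le_predim {α : ℝ} (hα : 0 < α) (hlam : α * lam = 1) (hS : S.Finite)
    {U : Finset Bool} (hU : ∀ u ∈ U, Sum.inl u ∈ S) :
    U.card + α * ∑ p ∈ copies hS, R.leak S p ≤ predim α R.ladder S := by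
  have h1 : U.card + (copies hS).card ≤ S.ncard := by
    rw [← Finset.card_disjSum, ← Set.ncard_coe_finset]
    refine Set.ncard_le_ncard ?_ hS
    rintro (u | p) h
    · simp only [Finset.mem_coe, Finset.inl_mem_disjSum] at h
      exact hU u h
    · simpa using h
  have h1' : (U.card : ℝ) + (copies hS).card ≤ S.ncard := by exact_mod_cast h1
  have h2 := mul_le_mul_of_nonneg_left (R.edgeCount_add_leak_le hS) hα.le
  have h3 : α * ((copies hS).card * lam) = (copies hS).card := by
    rw [mul_left_comm, hlam, mul_one]
  unfold predim
  linarith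

theorem le_predim_of_mem {α : ℝ} (hα : 0 < α) (hlam : α * lam = 1) (hS : S.Finite)
    {U : Finset Bool} (hU : ∀ u ∈ U, Sum.inl u ∈ S) {p : ℕ × ℕ} (hp : Sum.inr p ∈ S) :
    U.card + α * R.leak S p ≤ predim α R.ladder S := by
  have h1 := R.add_leak_le_predim hα hlam hS hU
  have h2 : R.leak S p ≤ ∑ p ∈ copies hS, R.leak S p :=
    Finset.single_le_sum (f := fun p => R.leak S p) (fun p _ => R.leak_nonneg S p)
      ((mem_copies hS p).2 hp)
  have := mul_le_mul_of_nonneg_left h2 hα.le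
  linarith

theorem card_le_predim {α : ℝ} (hα : 0 < α) (hlam : α * lam = 1) (hS : S.Finite)
    {U : Finset Bool} (hU : ∀ u ∈ U, Sum.inl u ∈ S) : (U.card : ℝ) ≤ predim α R.ladder S := by
  have h1 := R.add_leak_le_predim hα hlam hS hU
  have h2 : 0 ≤ ∑ p ∈ copies hS, R.leak S p := Finset.sum_nonneg fun p _ => R.leak_nonneg S p
  have := mul_nonneg hα.le h2
  linarith

/-- A finite set containing one base point and the first vertex of a copy has predimension bounded
away from `1`. -/
theorem exists_gap {α : ℝ} (hα : 0 < α) (hα1 : α < 1) (hlam : α * lam = 1) :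
    ∃ ε > 0, ∀ (S : Set (Bool ⊕ (ℕ × ℕ))) (u : Bool) (q : ℕ), S.Finite → Sum.inl u ∈ S →
      Sum.inr (q, 0) ∈ S → 1 + ε ≤ predim α R.ladder S := by
  -- `η` is the least loss from breaking the path at one of the finitely many positions up to `l`.
  obtain ⟨η, hη, hη1, hηj⟩ : ∃ η : ℝ, 0 < η ∧ η ≤ 1 ∧
      ∀ j < R.l, η ≤ 1 - R.excess (j + 1) := by
    have hpos : ∀ j < R.l, 0 < 1 - R.excess (j + 1) := by
      intro j hj
      have := R.strict (j + 1) (by omega) (by omega)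
      unfold excess
      linarith
    rcases Nat.eq_zero_or_pos R.l with h0 | h0
    · exact ⟨1, one_pos, le_rfl, by omega⟩
    · obtain ⟨j, hj, hmin⟩ := Finset.exists_min_image (Finset.range R.l)
        (fun j => 1 - R.excess (j + 1)) ⟨0, by simpa⟩
      refine ⟨1 - R.excess (j + 1), hpos j (by simpa using hj), ?_, fun i hi =>
        hmin i (by simpa)⟩
      have := R.excess_nonneg (j + 1)
      linarith
  refine ⟨α * η, by positivity, fun S u q hS hu hq => ?_⟩
  have hsmall : α * η ≤ 1 := by nlinarith
  by_cases hall : ∀ u', Sum.inl u' ∈ S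
  · have := R.card_le_predim hα hlam hS (U := Finset.univ) (fun u' _ => hall u')
    simp at this
    linarith
  have key : ∃ p : ℕ × ℕ, Sum.inr p ∈ S ∧ η ≤ R.leak S p := by
    push Not at hall
    obtain ⟨u', hu'⟩ := hall
    cases u' with
    | false =>
      refine ⟨(q, 0), hq, hη1.trans (R.one_le_leak (d := 2) le_rfl ?_ ?_)⟩
      · have h1 := R.two_le
        have h2 := R.s_add_incr 0
        rw [R.s_zero] at h2
        simp only [zero_add] at h2
        simp only
        omega
      · simpa [target] using hu'
    | true =>
      -- Either the path reaches position `l`, where the edge to the missing base point leaks, or it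
      -- breaks earlier, where strictness gives a loss of at least `η`.
      by_cases hpath : ∀ j ≤ R.l, Sum.inr (q, j) ∈ S
      · refine ⟨(q, R.l), hpath _ le_rfl, hη1.trans (R.one_le_leak (d := R.b) R.two_le_b ?_ ?_)⟩
        · have h1 := R.b_le
          have h2 := R.s_add_incr R.l
          simp only
          omega
        · have h1 := R.two_le_b
          have h2 := R.ne_zero_two
          rw [target, if_neg (by omega), if_neg h2, if_pos ⟨rfl, rfl⟩]
          exact hu'
      · push Not at hpath
        obtain ⟨j, ⟨hjl, hj⟩, hmin⟩ : ∃ j, (j ≤ R.l ∧ Sum.inr (q, j) ∉ S) ∧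
            ∀ m < j, ¬ (m ≤ R.l ∧ Sum.inr (q, m) ∉ S) := by
          classical
          exact ⟨Nat.find hpath, Nat.find_spec hpath, fun m => Nat.find_min hpath⟩
        cases j with
        | zero => exact absurd hq hj
        | succ j =>
          refine ⟨(q, j), ?_, (hηj j (by omega)).trans (R.le_leak_of_not_mem (p := (q, j)) hj)⟩
          by_contra hnot
          exact hmin j (by omega) ⟨by omega, hnot⟩
  obtain ⟨p, hp, hleak⟩ := key
  have h1 := R.le_predim_of_mem hα hlam hS (U := {u}) (by simpa using hu) hp
  have h2 := mul_le_mul_of_nonneg_left hleak hα.le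
  simp at h1
  linarith

end Count

end Rounding

end Ladder

namespace Rounding

/-! ### Dense initial segments and Diophantine approximation -/

section Segment

variable {lam : ℝ} (R : Rounding lam)

/-- Edges inside a copy are told apart by length: 1 for path edges, 2 to `K` for backward ones, more
than `K` for forward ones. The edge to each base point has a single prescribed position and label.
-/
theorem edge_injective {q i d i' d' : ℕ} (hd : 1 ≤ d) (hd' : 1 ≤ d') (h : d ≤ R.K) (h' : d' ≤ R.K)
    (heq : s(Sum.inr (q, i), R.target q i d) = s(Sum.inr (q, i'), R.target q i' d')) :
    i = i' ∧ d = d' := by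
  rw [Sym2.eq_iff] at heq
  unfold target at heq
  split_ifs at heq <;> simp at heq <;> omega

/-- The two base points together with the first `N` vertices of the `q`-th copy. -/
def segment (N q : ℕ) : Finset (Bool ⊕ (ℕ × ℕ)) :=
  Finset.univ.disjSum ((Finset.range N).map ⟨fun i => (q, i), fun i j h => by simpa using h⟩)

@[simp]
theorem inl_mem_segment (N q : ℕ) (u : Bool) : Sum.inl u ∈ segment N q := by
  simp [segment]

@[simp]
theorem inr_mem_segment (N q i : ℕ) : Sum.inr (q, i) ∈ segment N q ↔ i < N := by
  simp only [segment, Finset.inr_mem_disjSum, Finset.mem_map, Finset.mem_range]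
  exact ⟨fun ⟨_, ha, h⟩ => (Prod.mk.inj h).2 ▸ ha, fun h => ⟨i, h, rfl⟩⟩

theorem card_segment (N q : ℕ) : (segment N q).card = N + 2 := by
  simp [segment, add_comm]

theorem sum_incr (N : ℕ) : ∑ i ∈ Finset.range N, R.incr i = R.s N := by
  induction N with
  | zero => simp [R.s_zero]
  | succ N ih => rw [Finset.sum_range_succ, ih, R.s_add_incr]

/-- Forward edges start below `K` and end below `3 * K`, so only the path edge of the last vertex
leaves the segment. -/
theorem target_mem_segment {N q i d : ℕ} (hN : 3 * R.K ≤ N) (hi : i < N) (hd : 1 ≤ d)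
    (hd' : d ≤ R.K) (hne : ¬ (i = N - 1 ∧ d = 1)) : R.target q i d ∈ segment N q := by
  unfold target
  split_ifs <;> simp <;> omega

theorem le_edgeCount_segment {N : ℕ} (hN : 3 * R.K ≤ N) (q : ℕ) :
    R.s N - 1 ≤ edgeCount R.ladder (segment N q : Set (Bool ⊕ (ℕ × ℕ))) := by
  classical
  set P : Finset (Σ _ : ℕ, ℕ) :=
    ((Finset.range N).sigma fun i => Finset.Icc 1 (R.incr i)).erase ⟨N - 1, 1⟩ with hP
  have hcard : R.s N - 1 ≤ P.card := by
    refine le_trans ?_ Finset.pred_card_le_card_erase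
    rw [Finset.card_sigma]
    simp [R.sum_incr]
  have hmem : ∀ a ∈ P, a.1 < N ∧ 1 ≤ a.2 ∧ a.2 ≤ R.incr a.1 ∧ ¬ (a.1 = N - 1 ∧ a.2 = 1) := by
    rintro ⟨i, d⟩ ha
    simp only [hP, Finset.mem_erase, Finset.mem_sigma, Finset.mem_range, Finset.mem_Icc] at ha
    refine ⟨ha.2.1, ha.2.2.1, ha.2.2.2, ?_⟩
    rintro ⟨rfl, rfl⟩
    exact ha.1 rfl
  have hinj : Set.InjOn (fun a : Σ _ : ℕ, ℕ => s(Sum.inr (q, a.1), R.target q a.1 a.2)) P := by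
    rintro ⟨i, d⟩ ha ⟨i', d'⟩ ha' h
    obtain ⟨-, h1, h2, -⟩ := hmem _ ha
    obtain ⟨-, h1', h2', -⟩ := hmem _ ha'
    obtain ⟨rfl, rfl⟩ := R.edge_injective h1 h1' (h2.trans (R.incr_le _))
      (h2'.trans (R.incr_le _)) h
    rfl
  rw [edgeCount_eq_ncard]
  refine hcard.trans ?_
  rw [← Finset.card_image_of_injOn hinj, ← Set.ncard_coe_finset]
  refine Set.ncard_le_ncard ?_ (finite_edgesIn (Finset.finite_toSet _))
  rw [Finset.coe_image]
  rintro _ ⟨⟨i, d⟩, ha, rfl⟩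
  obtain ⟨h0, h1, h2, h3⟩ := hmem _ ha
  refine ⟨?_, ?_⟩
  · rw [ladder, SimpleGraph.edgeSet_fromEdgeSet]
    refine ⟨⟨q, i, d, h1, h2, rfl⟩, ?_⟩
    exact fun h => R.target_ne h1 h2 h
  · simp only [Sym2.mem_iff, Finset.mem_coe]
    rintro v (rfl | rfl)
    · simpa using h0
    · exact R.target_mem_segment hN h0 h1 (h2.trans (R.incr_le _)) h3

end Segment

theorem exists_mul_near_int {lam ε : ℝ} (hε : 0 < ε) (n : ℕ) :
    ∃ N : ℕ, n ≤ N ∧ ∃ p : ℤ, (p : ℝ) ≤ N * lam ∧ N * lam ≤ p + ε := by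
  wlog hε1 : ε ≤ 1 generalizing ε
  · obtain ⟨N, hN, p, h1, h2⟩ := this one_pos le_rfl
    exact ⟨N, hN, p, h1, by linarith⟩
  obtain ⟨m, hm⟩ := exists_nat_gt ((n + 1) / ε)
  rw [div_lt_iff₀ hε] at hm
  have hm0 : 0 < m := by
    rcases Nat.eq_zero_or_pos m with rfl | h
    · simp at hm
      linarith [(Nat.cast_nonneg n : (0 : ℝ) ≤ n)]
    · exact h
  obtain ⟨k, hk, -, habs⟩ := Real.exists_nat_abs_mul_sub_round_le lam hm0
  set p := round (k * lam)
  have hn0 : (0 : ℝ) ≤ n := Nat.cast_nonneg n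
  have hsmall : (n + 1) * |k * lam - p| ≤ ε := by
    have hm' : (0 : ℝ) < m + 1 := by positivity
    calc (n + 1) * |k * lam - p| ≤ (m * ε) * (1 / (m + 1)) := by gcongr
      _ ≤ ε := by
        rw [mul_one_div, div_le_iff₀ hm']
        nlinarith
  -- A multiple kλ slightly above `p` stays close under multiplication by `n + 1`. If it is below
  -- `p` by φ, then ⌊1/φ⌋ such steps fall short by an amount in (1 - φ, 1], landing just above the
  -- previous integer.
  rcases le_or_gt 0 (k * lam - p) with h | h
  · refine ⟨k * (n + 1), by nlinarith, p * (n + 1), ?_, ?_⟩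
    · push_cast
      nlinarith
    · rw [abs_of_nonneg h] at hsmall
      push_cast
      nlinarith
  · rw [abs_of_neg h] at hsmall
    set φ := -(k * lam - p) with hφ
    have hφ0 : 0 < φ := by linarith
    have h1 : (⌊1 / φ⌋₊ : ℝ) * φ ≤ 1 := by
      rw [← le_div_iff₀ hφ0]
      exact Nat.floor_le (by positivity)
    have h2 : 1 < (⌊1 / φ⌋₊ + 1 : ℝ) * φ := by
      rw [← div_lt_iff₀ hφ0]
      exact Nat.lt_floor_add_one _
    have h3 : n + 1 ≤ ⌊1 / φ⌋₊ := by
      refine Nat.le_floor ?_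
      rw [le_div_iff₀ hφ0]
      push_cast
      linarith
    refine ⟨k * ⌊1 / φ⌋₊, by nlinarith, p * ⌊1 / φ⌋₊ - 1, ?_, ?_⟩
    · push_cast
      nlinarith
    · push_cast
      nlinarith

theorem exists_of_one_lt {lam : ℝ} (h : 1 < lam) :
    ∃ R : Rounding lam, ∀ i, 1 ≤ i → R.s i = ⌊i * lam⌋₊ + 1 := by
  set s : ℕ → ℕ := fun i => if i = 0 then 0 else ⌊i * lam⌋₊ + 1 with hs
  have hs0 : s 0 = 0 := rfl
  have hs1 : ∀ i, 1 ≤ i → s i = ⌊i * lam⌋₊ + 1 := fun i hi => if_neg (by omega)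
  have hlower : ∀ i : ℕ, i * lam ≤ s i := by
    intro i
    rcases Nat.eq_zero_or_pos i with rfl | hi
    · simp [hs0]
    · rw [hs1 i hi]
      push_cast
      exact (Nat.lt_floor_add_one _).le
  have hupper : ∀ i : ℕ, (s i : ℝ) ≤ i * lam + 1 := by
    intro i
    rcases Nat.eq_zero_or_pos i with rfl | hi
    · simp [hs0]
    · rw [hs1 i hi]
      push_cast
      have := Nat.floor_le (a := i * lam) (by positivity)
      linarith
  have hlt : ∀ i, s i + 1 ≤ s (i + 1) := by
    intro i
    rw [hs1 (i + 1) (by omega)]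
    rcases Nat.eq_zero_or_pos i with rfl | hi
    · simp [hs0]
    · rw [hs1 i hi]
      have : ⌊i * lam⌋₊ + 1 ≤ ⌊((i + 1 : ℕ) : ℝ) * lam⌋₊ := by
        refine Nat.le_floor ?_
        have := Nat.floor_le (a := i * lam) (by positivity)
        push_cast
        linarith
      omega
  have hle : ∀ i, s (i + 1) ≤ s i + (⌈lam⌉₊ + 1) := by
    intro i
    have h1 := hupper (i + 1)
    have h2 := hlower i
    have h3 := Nat.le_ceil lam
    have : (s (i + 1) : ℝ) ≤ (s i + (⌈lam⌉₊ + 1) : ℕ) := by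
      push_cast at h1 ⊢
      linarith
    exact_mod_cast this
  have htwo : 2 ≤ s 1 := by
    rw [hs1 1 le_rfl]
    have : 1 ≤ ⌊((1 : ℕ) : ℝ) * lam⌋₊ := Nat.le_floor (by push_cast; linarith)
    omega
  -- For λ ≥ 2 the initial vertex has a third edge to spare for the second base point. Otherwise it
  -- has only two, and `l` is the first later position with increment at least 2; up to there s(j) =
  -- j + 1 < jλ + 1.
  rcases le_or_gt 2 lam with h2 | h2
  · refine ⟨⟨s, _, 0, 3, hs0, hlt, hle, hlower, hupper, htwo, by omega, ?_, by omega, by omega⟩,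
      hs1⟩
    rw [hs1 (0 + 1) (by omega)]
    have : 2 ≤ ⌊((0 + 1 : ℕ) : ℝ) * lam⌋₊ := Nat.le_floor (by push_cast; linarith)
    rw [hs0]
    omega
  · have hs2 : s 1 = 2 := by
      have : ⌊((1 : ℕ) : ℝ) * lam⌋₊ < 2 := by
        rw [Nat.floor_lt (by positivity)]
        push_cast
        linarith
      rw [hs1 1 le_rfl] at htwo ⊢
      omega
    have hlin : ∀ n, (∀ i, 1 ≤ i → i < n → ¬ s i + 2 ≤ s (i + 1)) → ∀ j, 1 ≤ j → j ≤ n →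
        s j = j + 1 := by
      intro n hn j hj
      induction j, hj using Nat.le_induction with
      | base => exact fun _ => hs2
      | succ j hj ih =>
        intro hjn
        have h1 := ih (by omega)
        have h2 := hn j hj (by omega)
        have h3 := hlt j
        omega
    have hex : ∃ i, 1 ≤ i ∧ s i + 2 ≤ s (i + 1) := by
      by_contra hno
      push Not at hno
      obtain ⟨n, hn⟩ := exists_nat_gt (1 / (lam - 1))
      rw [div_lt_iff₀ (by linarith)] at hn
      have h1 := hlin (n + 1) (fun i hi _ => by have := hno i hi; omega) (n + 1) (by omega) le_rfl
      have h3 := hlower (n + 1)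
      rw [h1] at h3
      push_cast at h3
      nlinarith
    obtain ⟨l, ⟨hl1, hl⟩, hmin⟩ : ∃ l, (1 ≤ l ∧ s l + 2 ≤ s (l + 1)) ∧
        ∀ m < l, ¬ (1 ≤ m ∧ s m + 2 ≤ s (m + 1)) := by
      classical
      exact ⟨Nat.find hex, Nat.find_spec hex, fun m => Nat.find_min hex⟩
    refine ⟨⟨s, _, l, 2, hs0, hlt, hle, hlower, hupper, htwo, le_rfl, hl, by omega, ?_⟩, hs1⟩
    intro j hj hjl
    rw [hlin l (fun i hi hil hc => hmin i hil ⟨hi, hc⟩) j hj hjl]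
    have : (1 : ℝ) ≤ j := by exact_mod_cast hj
    push_cast
    nlinarith

end Rounding

/-- A graph in which every copy of a vertex has dimension `0` over two base points, but positive
dimension over each of them. -/
theorem exists_ladder {α : ℝ} (hα0 : 0 < α) (hα1 : α < 1) :
    ∃ H : SimpleGraph (Bool ⊕ (ℕ × ℕ)), (∀ u v, ¬ H.Adj (Sum.inl u) (Sum.inl v)) ∧
      (∀ (S : Set (Bool ⊕ (ℕ × ℕ))) (U : Finset Bool), S.Finite → (∀ u ∈ U, Sum.inl u ∈ S) →
        (U.card : ℝ) ≤ predim α H S) ∧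
      (∃ ε > 0, ∀ (S : Set (Bool ⊕ (ℕ × ℕ))) (u : Bool) (q : ℕ), S.Finite → Sum.inl u ∈ S →
        Sum.inr (q, 0) ∈ S → 1 + ε ≤ predim α H S) ∧
      ∀ η > 0, ∃ m e : ℕ, (m : ℝ) - α * e ≤ 2 + η ∧ ∀ q : ℕ, ∃ S : Finset (Bool ⊕ (ℕ × ℕ)),
        (∀ u, Sum.inl u ∈ S) ∧ Sum.inr (q, 0) ∈ S ∧ S.card = m ∧
          e ≤ edgeCount H (S : Set (Bool ⊕ (ℕ × ℕ))) := by
  have hlam : α * α⁻¹ = 1 := mul_inv_cancel₀ hα0.ne'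
  obtain ⟨R, hR⟩ := Rounding.exists_of_one_lt ((one_lt_inv₀ hα0).2 hα1)
  refine ⟨R.ladder, R.not_adj_base, fun S U hS hU => R.card_le_predim hα0 hlam hS hU,
    R.exists_gap hα0 hα1 hlam, fun η hη => ?_⟩
  obtain ⟨N, hN, p, hp1, hp2⟩ := Rounding.exists_mul_near_int (lam := α⁻¹) hη (3 * R.K + 1)
  -- Losing the last path edge costs exactly the 1 in s(N) = ⌊Nλ⌋ + 1.
  refine ⟨N + 2, R.s N - 1, ?_, fun q => ⟨Rounding.segment N q, by simp, by simp; omega,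
    Rounding.card_segment N q, R.le_edgeCount_segment (by omega) q⟩⟩
  rw [hR N (by omega), Nat.add_sub_cancel]
  have h1 : p ≤ (⌊(N : ℝ) * α⁻¹⌋₊ : ℤ) := by
    rw [Int.natCast_floor_eq_floor (by positivity)]
    exact Int.le_floor.2 hp1
  have h2 : (p : ℝ) ≤ (⌊(N : ℝ) * α⁻¹⌋₊ : ℝ) := by exact_mod_cast h1
  have h3 : α * (N * α⁻¹ - η) ≤ α * (⌊(N : ℝ) * α⁻¹⌋₊ : ℝ) :=
    mul_le_mul_of_nonneg_left (by linarith) hα0.le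
  have h4 : α * (N * α⁻¹ - η) = N - α * η := by
    rw [mul_sub, mul_left_comm, hlam, mul_one]
  have h5 : α * η ≤ η := by nlinarith
  push_cast
  linarith

/-! ### Strong embeddings into the generic graph -/

section Embedding

variable {V : Type*} {G : SimpleGraph V} {α : ℝ}

theorem IsHereditarilyNonneg.of_embedding {W : Type*} {H : SimpleGraph W}
    (hG : IsHereditarilyNonneg α G) (g : H ↪g G) : IsHereditarilyNonneg α H := fun A hA => by
  rw [← predim_image g]
  exact hG _ (hA.image g)

/-- The extension property of a generic graph for graphs on arbitrary finite types. -/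
theorem IsGeneric.exists_embedding (hG : IsGeneric α G) {W : Type*} [Finite W]
    {H : SimpleGraph W} (hH : IsHereditarilyNonneg α H) {A : Set V} (hA : A.Finite)
    (hAG : IsStrong α G A Set.univ) (f : G.induce A ↪g H)
    (hf : IsStrong α H (Set.range f) Set.univ) :
    ∃ g : H ↪g G, (∀ a : A, g (f a) = a) ∧ IsStrong α G (Set.range g) Set.univ := by
  let e := Finite.equivFin W
  let φ : H.comap e.symm ≃g H := SimpleGraph.Iso.comap e.symm H
  have hH' : IsHereditarilyNonneg α (H.comap e.symm) := hH.of_embedding φ.toEmbedding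
  obtain ⟨g, hg, hgs⟩ := hG.extension A hA hAG _ (H.comap e.symm) hH'
    (φ.symm.toEmbedding.comp f) (by
      rw [isStrong_iff hH' (Set.toFinite _)]
      rw [isStrong_iff hH (Set.toFinite _)] at hf
      refine ⟨Set.subset_univ _, fun B _ hB _ => ?_⟩
      have himg : φ.toEmbedding '' Set.range (φ.symm.toEmbedding.comp f) = Set.range f := by
        rw [← Set.range_comp]
        congr 1
        ext a
        exact φ.apply_symm_apply (f a)
      rw [← predim_image φ.toEmbedding, ← predim_image φ.toEmbedding B, himg]
      refine hf.2 _ (Set.toFinite _) ?_ (Set.subset_univ _)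
      rw [← himg]
      exact Set.image_mono hB)
  refine ⟨g.comp φ.symm.toEmbedding, hg, ?_⟩
  have : Set.range (g.comp φ.symm.toEmbedding) = Set.range g :=
    φ.symm.surjective.range_comp g
  rwa [this]

/-- A generic graph contains a strong pair of nonadjacent vertices. -/
theorem IsGeneric.exists_pair (hα : 0 ≤ α) (hG : IsGeneric α G) :
    ∃ g : (⊥ : SimpleGraph Bool) ↪g G, IsStrong α G (Set.range g) Set.univ := by
  have hbot : ∀ A : Set Bool, predim α (⊥ : SimpleGraph Bool) A = A.ncard := by
    intro A
    simp [predim, edgeCount]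
  have hempty : ∀ {W : Type _} (H : SimpleGraph W), predim α H ∅ ≤ 0 := by
    intro W H
    exact (predim_le_ncard hα ∅).trans (by simp)
  have hH : IsHereditarilyNonneg α (⊥ : SimpleGraph Bool) := fun A _ => by
    rw [hbot]
    positivity
  have : IsEmpty (∅ : Set V) := Set.isEmpty_coe_sort.2 rfl
  let f : G.induce (∅ : Set V) ↪g (⊥ : SimpleGraph Bool) :=
    ⟨⟨fun a => isEmptyElim a, fun a => isEmptyElim a⟩, fun {a} => isEmptyElim a⟩
  obtain ⟨g, -, hg⟩ := hG.exists_embedding hH Set.finite_empty (by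
      rw [isStrong_iff hG.hereditary Set.finite_empty]
      exact ⟨Set.empty_subset _, fun B hB _ _ => (hempty G).trans (hG.hereditary B hB)⟩) f (by
      rw [isStrong_iff hH (Set.toFinite _), Set.range_eq_empty f]
      refine ⟨Set.empty_subset _, fun B _ _ _ => ?_⟩
      rw [hbot, hbot]
      simp)
  exact ⟨g, hg⟩

/-- Finite parts of a graph over two base points embed into a generic graph over a strong pair. -/
theorem IsGeneric.exists_embedding_over_pair (hG : IsGeneric α G) {W : Type*}
    {H : SimpleGraph (Bool ⊕ W)} (hα : 0 ≤ α) (hadj : ∀ u v, ¬ H.Adj (Sum.inl u) (Sum.inl v))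
    (hH : ∀ (S : Set (Bool ⊕ W)) (U : Finset Bool), S.Finite → (∀ u ∈ U, Sum.inl u ∈ S) →
        (U.card : ℝ) ≤ predim α H S)
    {g₀ : (⊥ : SimpleGraph Bool) ↪g G} (hg₀ : IsStrong α G (Set.range g₀) Set.univ)
    (F : Finset (Bool ⊕ W)) (hF : ∀ u, Sum.inl u ∈ F) :
    ∃ g : H.induce (F : Set (Bool ⊕ W)) ↪g G, (∀ u, g ⟨Sum.inl u, hF u⟩ = g₀ u) ∧
      IsStrong α G (Set.range g) Set.univ := by
  let e : Bool ≃ Set.range g₀ := Equiv.ofInjective g₀ g₀.injective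
  let ι : H.induce (F : Set (Bool ⊕ W)) ↪g H := SimpleGraph.Embedding.induce _
  have hhered : IsHereditarilyNonneg α (H.induce (F : Set (Bool ⊕ W))) := by
    refine IsHereditarilyNonneg.of_embedding (fun S hS => ?_) ι
    simpa using hH S ∅ hS (by simp)
  let f : G.induce (Set.range g₀) ↪g H.induce (F : Set (Bool ⊕ W)) :=
    ⟨⟨fun a => ⟨Sum.inl (e.symm a), hF _⟩, fun a b h => by simpa using h⟩, by
      intro a b
      obtain ⟨u, rfl⟩ := e.surjective a
      obtain ⟨v, rfl⟩ := e.surjective b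
      have h1 : ¬ G.Adj (g₀ u) (g₀ v) := by
        rw [g₀.map_adj_iff]
        simp
      exact iff_of_false (hadj _ _) h1⟩
  have hfe : ∀ u, f (e u) = ⟨Sum.inl u, hF u⟩ := fun u =>
    Subtype.ext (congrArg Sum.inl (e.symm_apply_apply u))
  obtain ⟨g, hg, hgs⟩ := hG.exists_embedding hhered (Set.finite_range g₀) hg₀ f (by
    rw [isStrong_iff hhered (Set.toFinite _)]
    refine ⟨Set.subset_univ _, fun B hB hsub _ => ?_⟩
    have h1 : predim α (H.induce (F : Set (Bool ⊕ W))) (Set.range f) ≤ 2 := by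
      refine (predim_le_ncard hα _).trans ?_
      have : (Set.range f).ncard = 2 := by
        rw [← Set.image_univ, Set.ncard_image_of_injective _ f.injective, Set.ncard_univ,
          ← Nat.card_congr e]
        simp
      rw [this]
      norm_num
    -- The bound `hH` with `U` empty gave membership in the class; with both base points it shows
    -- that the pair is strong in the finite piece.
    have h2 := hH (ι '' B) Finset.univ (hB.image _) (fun u _ =>
      ⟨⟨Sum.inl u, hF u⟩, hsub ⟨e u, hfe u⟩, rfl⟩)
    rw [predim_image] at h2
    simp at h2
    linarith)
  refine ⟨g, fun u => ?_, hgs⟩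
  rw [← hfe, hg]
  rfl

end Embedding

/-! ### Infinitely many approximate solutions in the generic graph -/

section Solutions

variable {V : Type*} [FirstOrder.Language.graph.Structure V] [V ⊨ Theory.simpleGraph] {α : ℝ}

/-- The vertices that lie in dense sets of the sizes `m i`, `i ≤ n`, over the pair `v`, and that
have dimension at least `1 + ε` together with each element of `v`. -/
def solutions (α ε : ℝ) (m e : ℕ → ℕ) (v : Bool → V) (n : ℕ) : Set V :=
  {z | (∀ u B, B.Finite → v u ∈ B → z ∈ B → 1 + ε ≤ predim α (simpleGraphOfStructure V) B) ∧
    ∀ i ≤ n, (denseFormula (Bool ⊕ Fin 1) (m i) (e i)).Realize (Sum.elim v (fun _ => z))}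

/-- A generic graph contains a strong pair over which all the sets of solutions are infinite. -/
theorem IsGeneric.exists_infinite_solutions (hα0 : 0 < α) (hα1 : α < 1)
    (hG : IsGeneric α (simpleGraphOfStructure V)) :
    ∃ ε > 0, ∃ m e : ℕ → ℕ, (∀ n, (m n : ℝ) - α * e n ≤ 2 + 1 / (n + 1)) ∧
      ∃ v : Bool → V, (∀ B : Set V, B.Finite → (∀ u, v u ∈ B) →
        2 ≤ predim α (simpleGraphOfStructure V) B) ∧
        Function.Injective v ∧ ∀ n, (solutions α ε m e v n).Infinite := by
  classical
  obtain ⟨H, hadj, hH, ⟨ε, hε, hgap⟩, hdense⟩ := exists_ladder hα0 hα1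
  choose m e hme S hSbase hSc hScard hSe using
    fun n : ℕ => hdense (1 / ((n : ℝ) + 1)) (by positivity)
  obtain ⟨g₀, hg₀⟩ := hG.exists_pair hα0.le
  refine ⟨ε, hε, m, e, hme, g₀, fun B hB hv => ?_, g₀.injective, fun n hfin => ?_⟩
  · have h1 := ((isStrong_iff hG.hereditary (Set.finite_range g₀)).1 hg₀).2 B hB
      (by rintro _ ⟨u, rfl⟩; exact hv u) (Set.subset_univ _)
    rw [← Set.image_univ, predim_image] at h1
    simpa [predim, edgeCount, Set.ncard_univ] using h1
  -- One copy more than the supposed number of solutions is embedded; distinct copies have distinct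
  -- initial vertices.
  · set k := hfin.toFinset.card + 1 with hk
    let F : Finset (Bool ⊕ (ℕ × ℕ)) :=
      (Finset.range (n + 1)).biUnion fun i => (Finset.range k).biUnion fun q => S i q
    have hSF : ∀ i ≤ n, ∀ q < k, S i q ⊆ F := by
      intro i hi q hq a ha
      simp only [F, Finset.mem_biUnion, Finset.mem_range]
      exact ⟨i, by omega, q, hq, ha⟩
    have hF : ∀ u, Sum.inl u ∈ F := fun u => hSF 0 (by omega) 0 (by omega) (hSbase 0 0 u)
    have hFc : ∀ q < k, Sum.inr (q, 0) ∈ F := fun q hq => hSF 0 (by omega) q hq (hSc 0 q)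
    obtain ⟨g, hg, hgs⟩ := hG.exists_embedding_over_pair hα0.le hadj hH hg₀ F hF
    let ι : H.induce (F : Set (Bool ⊕ (ℕ × ℕ))) ↪g H := SimpleGraph.Embedding.induce _
    have hmem : ∀ q : Fin k, g ⟨Sum.inr ((q : ℕ), 0), hFc q q.2⟩ ∈
        solutions α ε m e g₀ n := by
      intro q
      refine ⟨fun u B hB hu hz => ?_, fun i hi => ?_⟩
      -- Strength of the image reduces an arbitrary finite set in the generic graph to its trace on
      -- the ladder, where the gap is known.
      · refine le_trans ?_ (hgs.predim_inter_le hα0.le hG.hereditary (Set.finite_range g) hB)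
        rw [← Set.image_preimage_eq_inter_range, predim_image, ← predim_image ι]
        refine hgap _ u q (Set.toFinite _) ⟨⟨Sum.inl u, hF u⟩, ?_, rfl⟩ ⟨_, hz, rfl⟩
        rw [Set.mem_preimage, hg]
        exact hu
      · have himg : ι '' (ι ⁻¹' (S i q : Set _)) = S i q :=
          Set.image_preimage_eq_of_subset fun a ha => ⟨⟨a, hSF i hi q q.2 ha⟩, rfl⟩
        rw [realize_denseFormula]
        refine ⟨g '' (ι ⁻¹' (S i q : Set _)), Set.toFinite _, ?_, ?_, ?_⟩
        · rintro (u | j)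
          · exact ⟨⟨Sum.inl u, hF u⟩, hSbase i q u, hg u⟩
          · exact ⟨_, hSc i q, rfl⟩
        · rw [Set.ncard_image_of_injective _ g.injective,
            ← Set.ncard_image_of_injective _ ι.injective, himg, Set.ncard_coe_finset, hScard]
        · rw [edgeCount_image, ← edgeCount_image ι, himg]
          exact hSe i q
    have := Finset.card_le_card_of_injOn (s := (Finset.univ : Finset (Fin k)))
      (t := hfin.toFinset) (fun q => g ⟨Sum.inr ((q : ℕ), 0), hFc q q.2⟩)
      (fun q _ => by simpa using hmem q) (fun q _ q' _ h => by
        have := g.injective h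
        simp at this
        exact Fin.ext this)
    simp [hk] at this

end Solutions

/-! ### Transfer to the saturated model -/

section Transfer

variable {V : Type*} [FirstOrder.Language.graph.Structure V] [V ⊨ Theory.simpleGraph]
variable {M : Type*} [FirstOrder.Language.graph.Structure M] [M ⊨ Theory.simpleGraph] {α : ℝ}

theorem SameType.comp {L : FirstOrder.Language.{v, w}} {N N' : Type*} [L.Structure N]
    [L.Structure N'] {γ γ' : Type} {v : γ → N} {w : γ → N'} (h : SameType (L := L) v w)
    (f : γ' → γ) : SameType (L := L) (v ∘ f) (w ∘ f) := fun φ => by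
  rw [← Formula.realize_relabel, ← Formula.realize_relabel]
  exact h _

/-- Lower bounds for the predimension of the finite sets containing a tuple are determined by the
type of the tuple. -/
theorem SameType.le_predim (hα : 0 ≤ α) {γ : Type} [Finite γ] {v : γ → V} {w : γ → M}
    (h : SameType (L := FirstOrder.Language.graph) v w) {r : ℝ}
    (hr : ∀ B : Set V, B.Finite → (∀ i, v i ∈ B) → r ≤ predim α (simpleGraphOfStructure V) B)
    {B : Set M} (hB : B.Finite) (hw : ∀ i, w i ∈ B) :
    r ≤ predim α (simpleGraphOfStructure M) B := by
  have h1 : (denseFormula γ B.ncard (edgeCount (simpleGraphOfStructure M) B)).Realize w :=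
    realize_denseFormula.2 ⟨B, hB, hw, rfl, le_rfl⟩
  rw [← h, realize_denseFormula] at h1
  obtain ⟨C, hC, hv, hcard, he⟩ := h1
  refine (hr C hC hv).trans ?_
  have he' : (edgeCount (simpleGraphOfStructure M) B : ℝ) ≤
      edgeCount (simpleGraphOfStructure V) C := by exact_mod_cast he
  have := mul_le_mul_of_nonneg_left he' hα
  unfold predim
  rw [hcard]
  linarith

/-- The formula in the variables `v` and `z` refuting that `v u` and `z` lie in a set of `m`
vertices spanning at least `e` edges. -/
def sparseFormula (u : Bool) (m e : ℕ) : FirstOrder.Language.graph.Formula (Bool ⊕ Fin 1) :=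
  ((denseFormula Bool m e).relabel fun i => if i then Sum.inr 0 else Sum.inl u).not

theorem realize_sparseFormula {u : Bool} {m e : ℕ} {w : Bool → M} {z : M} :
    (sparseFormula u m e).Realize (Sum.elim w (fun _ => z)) ↔
      ∀ B : Set M, B.Finite → w u ∈ B → z ∈ B → B.ncard = m →
        ¬ e ≤ edgeCount (simpleGraphOfStructure M) B := by
  rw [sparseFormula, Formula.realize_not, Formula.realize_relabel, realize_denseFormula]
  constructor
  · intro h B hB hu hz hm he
    refine h ⟨B, hB, ?_, hm, he⟩
    rintro (_ | _) <;> simpa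
  · rintro h ⟨B, hB, hv, hm, he⟩
    exact h B hB (by simpa using hv false) (by simpa using hv true) hm he

/-- The set of formulas that express membership in all the sets `solutions α ε m e v n`. -/
def solutionFormulas (α ε : ℝ) (m e : ℕ → ℕ) :
    Set (FirstOrder.Language.graph.Formula (Bool ⊕ Fin 1)) :=
  {φ | (∃ n, φ = denseFormula (Bool ⊕ Fin 1) (m n) (e n)) ∨
    ∃ (u : Bool) (k l : ℕ), (k : ℝ) - α * l < 1 + ε ∧ φ = sparseFormula u k l}

theorem exists_solutions_subset (hα : 0 ≤ α) {ε : ℝ} {m e : ℕ → ℕ} (v : Bool → V)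
    {Δ : Set (FirstOrder.Language.graph.Formula (Bool ⊕ Fin 1))} (hΔ : Δ.Finite)
    (hsub : Δ ⊆ solutionFormulas α ε m e) :
    ∃ n, ∀ z ∈ solutions α ε m e v n, ∀ φ ∈ Δ, φ.Realize (Sum.elim v (fun _ => z)) := by
  have key : ∀ φ : Δ, ∃ n, ∀ n', n ≤ n' → ∀ z ∈ solutions α ε m e v n',
      φ.1.Realize (Sum.elim v (fun _ => z)) := by
    rintro ⟨φ, hφ⟩
    rcases hsub hφ with ⟨n, rfl⟩ | ⟨u, k, l, hkl, rfl⟩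
    · exact ⟨n, fun n' hn' z hz => hz.2 n hn'⟩
    · refine ⟨0, fun n' _ z hz => ?_⟩
      refine realize_sparseFormula.2 fun B hB hu hzB hk hl => ?_
      have h1 := hz.1 u B hB hu hzB
      have hl' : (l : ℝ) ≤ edgeCount (simpleGraphOfStructure V) B := by exact_mod_cast hl
      have := mul_le_mul_of_nonneg_left hl' hα
      rw [predim, hk] at h1
      linarith
  choose n hn using key
  have : Finite Δ := hΔ
  obtain ⟨N, hN⟩ := (Set.finite_range n).bddAbove
  exact ⟨N, fun z hz φ hφ => hn ⟨φ, hφ⟩ N (hN ⟨_, rfl⟩) z hz⟩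

theorem le_predim_of_realize {ε : ℝ} {w : Bool → M} {z : M} {m e : ℕ → ℕ}
    (h : ∀ φ ∈ solutionFormulas α ε m e, φ.Realize (Sum.elim w (fun _ => z))) {u : Bool}
    {B : Set M} (hB : B.Finite) (hu : w u ∈ B) (hz : z ∈ B) :
    1 + ε ≤ predim α (simpleGraphOfStructure M) B := by
  by_contra hlt
  exact realize_sparseFormula.1 (h _ (Or.inr ⟨u, B.ncard, _, not_le.1 hlt, rfl⟩)) B hB hu hz rfl
    le_rfl

/-- An element that is generic among the solutions of a set of formulas without algebraic
consequences. -/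
theorem IsSaturated.exists_realize_not_algebraic {L : FirstOrder.Language.{v, w}} {M : Type u}
    [L.Structure M] (hM : IsSaturated L M Cardinal.aleph0) {γ : Type} {B : Set M}
    (hB : B.Finite) (w : γ → B) (Θ : Set (L.Formula (γ ⊕ Fin 1)))
    (hΘ : ∀ Δ : Set (L.Formula (γ ⊕ Fin 1)), Δ.Finite → Δ ⊆ Θ →
      {a : M | ∀ φ ∈ Δ, φ.Realize (Sum.elim (fun i => (w i : M)) (fun _ => a))}.Infinite) :
    ∃ c : M, (∀ φ ∈ Θ, φ.Realize (Sum.elim (fun i => (w i : M)) (fun _ => c))) ∧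
      ∀ φ : (L[[B]]).Formula (Fin 1), {a : M | φ.Realize (fun _ => a)}.Finite →
        ¬ φ.Realize (fun _ => c) := by
  obtain ⟨c, hc⟩ := hM.exists_realize hB
    (substParams w '' Θ ∪ Formula.not '' {φ | {a : M | φ.Realize (fun _ => a)}.Finite}) (by
      intro Δ hΔ hsub
      obtain ⟨Δ₁, hΔ₁, hfin₁, h₁⟩ := Set.exists_subset_image_finite_and.1
        ⟨Δ ∩ substParams w '' Θ, Set.inter_subset_right, hΔ.inter_of_left _,
          (rfl : Δ ∩ substParams w '' Θ = Δ ∩ substParams w '' Θ)⟩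
      have hfin₂ : (⋃ φ ∈ Δ ∩ Formula.not '' {φ | {a : M | φ.Realize (fun _ => a)}.Finite},
          {a : M | ¬ φ.Realize (fun _ => a)}).Finite := by
        refine (hΔ.inter_of_left _).biUnion ?_
        rintro _ ⟨-, φ, hφ, rfl⟩
        simpa [Formula.realize_not] using hφ
      -- Finitely many algebraic formulas remove only finitely many points from an infinite solution
      -- set.
      obtain ⟨a, ha, hna⟩ := ((hΘ Δ₁ hfin₁ hΔ₁).sdiff hfin₂).nonempty
      refine ⟨a, fun φ hφ => ?_⟩
      rcases hsub hφ with h | h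
      · have h' : φ ∈ substParams w '' Δ₁ := by
          rw [← h₁]
          exact ⟨hφ, h⟩
        obtain ⟨ψ, hψ, rfl⟩ := h'
        exact (realize_substParams w ψ a).2 (ha ψ hψ)
      · by_contra hn
        exact hna (Set.mem_biUnion ⟨hφ, h⟩ hn))
  refine ⟨c, fun φ hφ => (realize_substParams w φ c).1 (hc _ (Or.inl ⟨φ, hφ, rfl⟩)),
    fun φ hφ => ?_⟩
  exact Formula.realize_not.1 (hc _ (Or.inr ⟨φ, hφ, rfl⟩))

end Transfer

end GenericGraph

end

/-! ### The main theorem -/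

theorem mainTheorem3 (α : ℝ) (hα0 : 0 < α) (hα1 : α < 1)
    {V : Type*} [FirstOrder.Language.graph.Structure V] [V ⊨ Theory.simpleGraph]
    (hV : GenericGraph.IsGeneric α (simpleGraphOfStructure V))
    {M : Type*} [FirstOrder.Language.graph.Structure M] [M ⊨ Theory.simpleGraph]
    (hVM : FirstOrder.Language.graph.ElementarilyEquivalent V M)
    (hM : GenericGraph.IsSaturated FirstOrder.Language.graph M Cardinal.aleph0) :
    ∃ x y c : M,
      x ≠ y ∧
      GenericGraph.DIndep α (simpleGraphOfStructure M) {x} {y} ∅ ∧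
      GenericGraph.relDim α (simpleGraphOfStructure M) {c} {x, y} = 0 ∧
      0 < GenericGraph.relDim α (simpleGraphOfStructure M) {c} {x} ∧
      0 < GenericGraph.relDim α (simpleGraphOfStructure M) {c} {y} ∧
      c ∉ GenericGraph.acl FirstOrder.Language.graph {x, y} ∧
      ∃ p : GenericGraph.OneType FirstOrder.Language.graph M {x, y},
        GenericGraph.RealizesType p c ∧
        ¬ GenericGraph.IsAlgebraicType p ∧
        GenericGraph.HasDRank α (simpleGraphOfStructure M) p 0 := by
  classical
  obtain ⟨ε, hε, m, e, hme, v, hv2, hvinj, hvinf⟩ :=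
    hV.exists_infinite_solutions hα0 hα1
  obtain ⟨x, hx⟩ := (GenericGraph.sameType_of_elementarilyEquivalent hVM Empty.elim
    Empty.elim).exists_extend hM (v false)
  obtain ⟨y, hy⟩ := hx.exists_extend hM (v true)
  set w : Bool → M := fun u => if u then y else x with hw
  have hvw : GenericGraph.SameType (L := FirstOrder.Language.graph) v w := by
    have := hy.comp (fun u : Bool => if u then Sum.inr 0 else Sum.inl (Sum.inr 0))
    convert this using 1 <;> (ext u; cases u <;> rfl)
  have hG : GenericGraph.IsHereditarilyNonneg α (simpleGraphOfStructure M) := fun B hB =>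
    (GenericGraph.sameType_of_elementarilyEquivalent hVM Empty.elim Empty.elim).le_predim hα0.le
      (fun C hC _ => hV.hereditary C hC) hB (by simp)
  have hxy : x ≠ y := by
    have h := hvw (((Term.var false).equal (Term.var true)).not)
    simp only [Formula.realize_not, Formula.realize_equal, Term.realize_var] at h
    exact h.1 fun h => by simpa using hvinj h
  have hpair : ∀ B : Set M, B.Finite → x ∈ B → y ∈ B →
      2 ≤ GenericGraph.predim α (simpleGraphOfStructure M) B := fun B hB h1 h2 =>
    hvw.le_predim hα0.le hv2 hB (by rintro (_ | _) <;> simpa [hw])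
  have hsingle : ∀ (u : Bool) (B : Set M), B.Finite → w u ∈ B →
      1 ≤ GenericGraph.predim α (simpleGraphOfStructure M) B := by
    intro u B hB hu
    -- Adding the other point raises the predimension by at most 1, so the bound 2 for the pair
    -- gives 1 for each point.
    have h1 := GenericGraph.predim_union_add_inter_le (G := simpleGraphOfStructure M) hα0.le hB
      (Set.finite_singleton (w !u))
    have h2 := hpair (B ∪ {w !u}) (hB.union (Set.finite_singleton _))
      (by cases u; exacts [Or.inl hu, Or.inr rfl]) (by cases u; exacts [Or.inr rfl, Or.inl hu])
    have h3 := hG (B ∩ {w !u}) (hB.inter_of_left _)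
    have h4 := GenericGraph.predim_le_ncard (G := simpleGraphOfStructure M) hα0.le {w !u}
    rw [Set.ncard_singleton] at h4
    push_cast at h4
    linarith
  have hdim0 : GenericGraph.dim α (simpleGraphOfStructure M) ∅ = 0 := by
    rw [GenericGraph.dim_eq_ncard hα0.le hG Set.finite_empty
      (fun B hB _ => by simpa using hG B hB)]
    simp
  have hdim1 : ∀ u, GenericGraph.dim α (simpleGraphOfStructure M) {w u} = 1 := by
    intro u
    rw [GenericGraph.dim_eq_ncard hα0.le hG (Set.finite_singleton _)
      (fun B hB h => by simpa using hsingle u B hB (by simpa using h))]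
    simp
  have hdim2 : GenericGraph.dim α (simpleGraphOfStructure M) {x, y} = 2 := by
    rw [GenericGraph.dim_eq_ncard hα0.le hG (Set.toFinite _) (fun B hB h => by
      rw [Set.ncard_pair hxy]
      exact_mod_cast hpair B hB (h (by simp)) (h (by simp))), Set.ncard_pair hxy]
    norm_num
  have hicl : ∀ u, GenericGraph.icl α (simpleGraphOfStructure M) {w u} ⊆ {w u} := by
    intro u
    refine GenericGraph.icl_subset_of_isStrong hG (Set.finite_singleton _) ?_
    rw [GenericGraph.isStrong_iff hG (Set.finite_singleton _)]
    refine ⟨Set.subset_univ _, fun B hB h _ => ?_⟩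
    refine le_trans (GenericGraph.predim_le_ncard hα0.le _) ?_
    simpa using hsingle u B hB (by simpa using h)
  let w' : Bool → ({x, y} : Set M) := fun u => ⟨w u, by cases u <;> simp [hw]⟩
  obtain ⟨c, hc, hcalg⟩ := hM.exists_realize_not_algebraic (Set.toFinite {x, y}) w'
    (GenericGraph.solutionFormulas α ε m e) (by
      intro Δ hΔ hsub
      have : Finite Δ := hΔ
      obtain ⟨n, hn⟩ := GenericGraph.exists_solutions_subset hα0.le v hΔ hsub
      have h1 := hvw.infinite_of_infinite (φ := Formula.iInf fun φ : Δ => φ.1)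
        ((hvinf n).mono fun z hz => Formula.realize_iInf.2 fun φ => hn z hz φ.1 φ.2)
      exact h1.mono fun a ha φ hφ => Formula.realize_iInf.1 ha ⟨φ, hφ⟩)
  -- Proved for an arbitrary `a`, since it must apply to every realization of the type as well as to
  -- `c`.
  have hrel : ∀ a : M, (∀ n, (GenericGraph.denseFormula (Bool ⊕ Fin 1) (m n) (e n)).Realize
      (Sum.elim w (fun _ => a))) →
      GenericGraph.relDim α (simpleGraphOfStructure M) {a} {x, y} = 0 := by
    intro a ha
    unfold GenericGraph.relDim
    rw [hdim2]
    refine le_antisymm (sub_nonpos.2 (le_of_forall_pos_le_add fun η hη => ?_)) ?_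
    · obtain ⟨n, hn⟩ := exists_nat_one_div_lt hη
      obtain ⟨B, hB, hmem, hcard, he⟩ := GenericGraph.realize_denseFormula.1 (ha n)
      have h1 : GenericGraph.dim α (simpleGraphOfStructure M) ({a} ∪ {x, y}) ≤
          GenericGraph.predim α (simpleGraphOfStructure M) B := by
        refine GenericGraph.dim_le_predim hG hB ?_
        have hmx := hmem (Sum.inl false)
        have hmy := hmem (Sum.inl true)
        have hma := hmem (Sum.inr 0)
        rintro z (rfl | rfl | rfl)
        · exact hma
        · exact hmx
        · exact hmy
      have he' : (e n : ℝ) ≤ GenericGraph.edgeCount (simpleGraphOfStructure M) B := by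
        exact_mod_cast he
      have h2 := mul_le_mul_of_nonneg_left he' hα0.le
      have h3 := hme n
      rw [GenericGraph.predim, hcard] at h1
      linarith
    · have := GenericGraph.dim_mono hG (A := {x, y}) (B := {a} ∪ {x, y}) (Set.toFinite _)
        Set.subset_union_right
      rw [hdim2] at this
      linarith
  have hgap : ∀ u, 0 < GenericGraph.relDim α (simpleGraphOfStructure M) {c} {w u} := by
    intro u
    have : 1 + ε ≤ GenericGraph.dim α (simpleGraphOfStructure M) ({c} ∪ {w u}) :=
      GenericGraph.le_dim (Set.toFinite _) fun B hB h =>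
        GenericGraph.le_predim_of_realize hc hB (u := u) (h (Or.inr rfl)) (h (Or.inl rfl))
    unfold GenericGraph.relDim
    rw [hdim1]
    linarith
  have : Nonempty M := ⟨c⟩
  let p : GenericGraph.OneType FirstOrder.Language.graph M {x, y} :=
    Theory.typeOf _ (fun _ : Fin 1 => c)
  have hp : ∀ φ : (FirstOrder.Language.graph[[({x, y} : Set M)]]).Formula (Fin 1),
      Formula.equivSentence φ ∈ p ↔ φ.Realize (fun _ => c) := fun φ =>
    Theory.CompleteType.formula_mem_typeOf
  refine ⟨x, y, c, hxy, ⟨?_, ?_⟩, hrel c fun n => hc _ (Or.inl ⟨n, rfl⟩), hgap false, hgap true, ?_,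
    p, fun φ hφ => (hp φ).1 hφ, ?_, ⟨c, fun φ hφ => (hp φ).1 hφ⟩, fun a ha => ?_⟩
  · have h1 := hdim1 false
    have h2 := hdim1 true
    simp only [hw, Bool.false_eq_true, if_false, if_true] at h1 h2
    rw [GenericGraph.relDim, GenericGraph.relDim, Set.union_empty, Set.empty_union,
      Set.singleton_union, hdim0, hdim2, h1, h2]
    norm_num
  · rintro z ⟨h1, h2⟩
    rw [Set.union_empty] at h1 h2
    exact absurd ((hicl false h1).symm.trans (hicl true h2)) hxy
  · rintro ⟨D, ⟨φ, hφ⟩, hD, hcD⟩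
    have hiff : ∀ a : M, a ∈ D ↔ φ.Realize (fun _ => a) := fun a =>
      Set.ext_iff.1 hφ (fun _ => a)
    refine hcalg φ (hD.subset fun a ha => (hiff a).2 ha) ((hiff c).1 hcD)
  · rintro ⟨φ, hφ, hfin⟩
    exact hcalg φ hfin ((hp φ).1 hφ)
  · refine hrel a fun n => ?_
    refine (GenericGraph.realize_substParams w' _ a).1 (ha _ ((hp _).2 ?_))
    exact (GenericGraph.realize_substParams w' _ c).2 (hc _ (Or.inl ⟨n, rfl⟩))
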